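/- Let $\mathbb X$ be a unital category (that is, a finitely complete category with zero morphisms in which, for all objects $X,Y$, every monomorphism into $X\times Y$ through which both quasi-injections $\iota_1=\langle 1_X,0\rangle\colon X\to X\times Y$ and $\iota_2=\langle 0,1_Y\rangle\colon Y\to X\times Y$ factor is an isomorphism) which is moreover regular and finitely cocomplete. Let $\mathsf{CMON}[\mathbb X]$ be the full subcategory of commutative objects, i.e. of the objects that admit an internal commutative monoid structure, with inclusion functor $\mathcal U\colon\mathsf{CMON}[\mathbb X]\to\mathbb X$. For every object $X$, the coequalizer $\mathrm{CMon}(X)$ of $\iota_1,\iota_2\colon X\rightrightarrows X\times X$ is a commutative object. The resulting functor $\mathrm{CMon}\colon\mathbb X\to\mathsf{CMON}[\mathbb X]$, which sends $f$ to the morphism induced by $f\times f$, is left adjoint to $\mathcal U$, with unit the composite of $\iota_1$ (equivalently $\iota_2$) with the coequalizing morphism. It is a linear reflector: $\mathsf{CMON}[\mathbb X]$ is closed under the finite products of $\mathbb X$, it is semi-additive (it has zero morphisms and finite biproducts), and $\mathrm{CMon}$ preserves finite products. Consequently the monad $(\mathcal L,\nu,\eta)$ of this adjunction, with $\mathcal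 L=\mathcal U\circ\mathrm{CMon}$, underlies a monadic linear assignment $(\mathcal L,+,0,\nu,\eta)$ on $\mathbb X$: $\mathcal L$ preserves finite products; $\nu\colon\mathcal L\mathcal L\to\mathcal L$ is a natural isomorphism with $\nu_{\mathcal L(X)}=\mathcal L(\nu_X)$; and $+_X\colon\mathcal L(X)\times\mathcal L(X)\to\mathcal L(X)$, $0_X\colon *\to\mathcal L(X)$ are natural transformations which make each $\mathcal L(X)$ a commutative monoid and each $\nu_X$ a monoid morphism. Here $+_X$ is the codiagonal of $\mathcal L(X)$, i.e. $+_X\circ\iota_1=1=+_X\circ\iota_2$. Finally, the $\mathcal L$-algebras, that is, the pairs $(A,a)$ with $a\colon\mathcal L(A)\to A$ an isomorphism such that $\mathcal L(a)=\nu_A$, correspond precisely to the commutative objects: an object $A$ is commutative if and only if it carries an $\mathcal L$-algebra structure, and there are isomorphisms of categories, compatible with the forgetful functors to $\mathbb X$, between $\mathsf{CMON}[\mathbb X]$ and the category $\mathcal L\text{-}\mathsf{ALG}$ of $\mathcal L$-algebras (whose morphisms $(A,a)\to(A',a')$ are the $f\colon A\to A'$ with $f\circ a=a'\circ\mathcal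 L(f)$), and between $\mathsf{CMON}[\mathbb X]$ and the full subcategory $\mathcal L\text{-}\mathsf{ALG}^\sharp$ of $\mathbb X$ on the objects $A$ for which $\eta_A\colon A\to\mathcal L(A)$ is an isomorphism. -/

import Mathlib

open CategoryTheory CategoryTheory.Limits MonoidalCategory CartesianMonoidalCategory

universe v u

namespace LinearReflector

section Pointed

variable {C : Type u} [Category.{v} C] [CartesianMonoidalCategory C] [HasZeroMorphisms C]

/-- The first quasi-injection `⟨1, 0⟩ : X ⟶ X × Y`. -/
def quasiInl (X Y : C) : X ⟶ X ⊗ Y := lift (𝟙 X) 0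

/-- The second quasi-injection `⟨0, 1⟩ : Y ⟶ X × Y`. -/
def quasiInr (X Y : C) : Y ⟶ X ⊗ Y := lift 0 (𝟙 Y)

lemma quasiInl_tensorHom {X Y X' Y' : C} (f : X ⟶ X') (g : Y ⟶ Y') :
    quasiInl X Y ≫ (f ⊗ₘ g) = f ≫ quasiInl X' Y' := by
  simp [quasiInl]

lemma quasiInr_tensorHom {X Y X' Y' : C} (f : X ⟶ X') (g : Y ⟶ Y') :
    quasiInr X Y ≫ (f ⊗ₘ g) = g ≫ quasiInr X' Y' := by
  simp [quasiInr]

variable (C) in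
/-- A unital category: a finitely complete category with zero morphisms in which, for all objects
`X` and `Y`, the quasi-injections into `X × Y` are jointly strongly epic, that is, every
monomorphism into `X × Y` through which both of them factor is an isomorphism. -/
class IsUnital : Prop extends HasFiniteLimits C where
  jointly_strongly_epic : ∀ {X Y M : C} (m : M ⟶ X ⊗ Y) [Mono m] (f : X ⟶ M) (g : Y ⟶ M),
    f ≫ m = quasiInl X Y → g ≫ m = quasiInr X Y → IsIso m

variable (C) in
/-- The functor sending `X` to the coequalizer of the two quasi-injections `X ⟶ X × X`, and a
morphism `f` to the morphism induced by `f × f`. -/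
noncomputable def coequalizerFunctor [HasFiniteColimits C] : C ⥤ C where
  obj X := coequalizer (quasiInl X X) (quasiInr X X)
  map {X Y} f := coequalizer.desc ((f ⊗ₘ f) ≫ coequalizer.π (quasiInl Y Y) (quasiInr Y Y)) (by
    rw [← Category.assoc, ← Category.assoc, quasiInl_tensorHom, quasiInr_tensorHom,
      Category.assoc, Category.assoc, coequalizer.condition])
  map_id X := by
    apply coequalizer.hom_ext
    simp only [coequalizer.π_desc, id_tensorHom_id, Category.id_comp, Category.comp_id]
  map_comp f g := by
    apply coequalizer.hom_ext
    rw [coequalizer.π_desc, coequalizer.π_desc_assoc, Category.assoc, coequalizer.π_desc,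
      ← tensorHom_comp_tensorHom, Category.assoc]

/-- The canonical morphism from `X` to the coequalizer of the two quasi-injections `X ⟶ X × X`:
the common composite of the quasi-injections with the coequalizing morphism. -/
noncomputable def toCoequalizer [HasFiniteColimits C] (X : C) :
    X ⟶ (coequalizerFunctor C).obj X :=
  quasiInl X X ≫ coequalizer.π (quasiInl X X) (quasiInr X X)

end Pointed

section CommutativeObjects

variable (C : Type u) [Category.{v} C] [CartesianMonoidalCategory C] [BraidedCategory C]

/-- Commutative objects: the objects that admit a structure of internal commutative monoid. -/
def commutativeObject : ObjectProperty C := fun X => ∃ _ : MonObj X, IsCommMonObj X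

/-- The full subcategory of commutative objects. -/
abbrev CMON : Type u := (commutativeObject C).FullSubcategory

end CommutativeObjects

section LinearSubcategories

/-- A semi-additive category: a category with zero morphisms and finite biproducts. -/
def IsSemiadditive (D : Type u) [Category.{v} D] : Prop :=
  ∃ _ : HasZeroMorphisms D, HasFiniteBiproducts D

variable {C : Type u} [Category.{v} C] [CartesianMonoidalCategory C]

/-- A (full) linear subcategory, given by its objects: it is closed under the finite products of
the ambient category (so that these are also its own finite products), and it is semi-additive (so
that these products are biproducts in it). -/
structure IsLinearSubcategory (P : ObjectProperty C) : Prop where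
  terminal_mem : P (𝟙_ C)
  prod_mem : ∀ X Y : C, P X → P Y → P (X ⊗ Y)
  semiadditive : IsSemiadditive P.FullSubcategory

/-- A linear reflector onto the full subcategory given by `P`. -/
structure IsLinearReflector (P : ObjectProperty C) (F : C ⥤ P.FullSubcategory) : Prop where
  linear : IsLinearSubcategory P
  reflector : Nonempty (F ⊣ P.ι)
  preservesFiniteProducts : PreservesFiniteProducts F

end LinearSubcategories

section LinearAssignments

variable (C : Type u) [Category.{v} C] [CartesianMonoidalCategory C] [BraidedCategory C]

/-- A linear assignment: an endofunctor preserving finite products, natural transformations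
`+ : L X × L X ⟶ L X` and `0 : * ⟶ L X` making each `L X` a commutative monoid (here `+` and `0`
are the multiplication `mul` and the unit `one` of a monoid object), and a natural isomorphism
`ν : L L X ≅ L X` such that each `ν_X` is a monoid morphism and `ν_{L X} = L (ν_X)`. -/
structure LinearAssignment where
  functor : C ⥤ C
  preservesFiniteProducts : PreservesFiniteProducts functor
  mon : ∀ X : C, MonObj (functor.obj X)
  comm : ∀ X : C, IsCommMonObj (functor.obj X)
  add_naturality : ∀ {X Y : C} (f : X ⟶ Y),
    (functor.map f ⊗ₘ functor.map f) ≫ MonObj.mul (X := functor.obj Y) =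
      MonObj.mul (X := functor.obj X) ≫ functor.map f
  zero_naturality : ∀ {X Y : C} (f : X ⟶ Y),
    MonObj.one (X := functor.obj X) ≫ functor.map f = MonObj.one (X := functor.obj Y)
  ν : functor ⋙ functor ≅ functor
  ν_isMonHom : ∀ X : C, @IsMonHom C _ _ (functor.obj (functor.obj X)) (functor.obj X)
    (mon (functor.obj X)) (mon X) (ν.hom.app X)
  ν_obj : ∀ X : C, ν.hom.app (functor.obj X) = functor.map (ν.hom.app X)

attribute [instance] LinearAssignment.mon LinearAssignment.comm

/-- A monadic linear assignment: a linear assignment `L` with a unit `1 ⟶ L` making `(L, ν, unit)`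
a monad. -/
structure MonadicLinearAssignment extends LinearAssignment C where
  unit : 𝟭 C ⟶ functor
  assoc : ∀ X : C, functor.map (ν.hom.app X) ≫ ν.hom.app X =
    ν.hom.app (functor.obj X) ≫ ν.hom.app X
  left_unit : ∀ X : C, unit.app (functor.obj X) ≫ ν.hom.app X = 𝟙 (functor.obj X)
  right_unit : ∀ X : C, functor.map (unit.app X) ≫ ν.hom.app X = 𝟙 (functor.obj X)

variable {C}

/-- The underlying monad of a monadic linear assignment. -/
def MonadicLinearAssignment.toMonad (L : MonadicLinearAssignment C) : Monad C where
  toFunctor := L.functor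
  η := L.unit
  μ := L.ν.hom
  assoc := L.assoc
  left_unit := L.left_unit
  right_unit := L.right_unit

/-- An algebra of a linear assignment `L`: an object `A` with an isomorphism `a : L A ≅ A` such
that `L a = ν_A`. -/
structure LinearAlgebra (L : LinearAssignment C) where
  obj : C
  str : L.functor.obj obj ≅ obj
  map_str : L.functor.map str.hom = L.ν.hom.app obj

/-- A morphism of algebras of a linear assignment. -/
@[ext]
structure LinearAlgebra.Hom {L : LinearAssignment C} (A B : LinearAlgebra L) where
  hom : A.obj ⟶ B.obj
  comm : L.functor.map hom ≫ B.str.hom = A.str.hom ≫ hom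

/-- The category of algebras of a linear assignment. -/
instance (L : LinearAssignment C) : Category (LinearAlgebra L) where
  Hom A B := LinearAlgebra.Hom A B
  id A := { hom := 𝟙 A.obj, comm := by simp }
  comp f g := { hom := f.hom ≫ g.hom,
                comm := by rw [Functor.map_comp, Category.assoc, g.comm, ← Category.assoc, f.comm,
                  Category.assoc] }
  id_comp f := LinearAlgebra.Hom.ext (Category.id_comp f.hom)
  comp_id f := LinearAlgebra.Hom.ext (Category.comp_id f.hom)
  assoc f g h := LinearAlgebra.Hom.ext (Category.assoc f.hom g.hom h.hom)

/-- The forgetful functor from the algebras of a linear assignment. -/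
def LinearAlgebra.forget (L : LinearAssignment C) : LinearAlgebra L ⥤ C where
  obj A := A.obj
  map f := f.hom
  map_id _ := rfl
  map_comp _ _ := rfl

/-- The objects `A` for which the unit `A ⟶ L A` of a monadic linear assignment is an
isomorphism. -/
def MonadicLinearAssignment.algSharp (L : MonadicLinearAssignment C) : ObjectProperty C :=
  fun A => IsIso (L.unit.app A)

end LinearAssignments

end LinearReflector

open LinearReflector

/-! Write L for `coequalizerFunctor` and η for `toCoequalizer`. In a unital category a morphism out
of `X ⊗ Y` is determined by its restrictions along the quasi-injections (`prod_hom_ext`). Hence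
codiagonals are unique, every morphism respects them, and a codiagonal is automatically a
commutative monoid multiplication: being commutative is a property (`commutativeObject_iff`). The
heart is `exists_isCodiagonal_coequalizerFunctor`: η is an extremal, hence regular, epimorphism, so
η × η is regular epi, and the coequalizing morphism X × X → L(X) factors through it as a codiagonal
of L(X). Morphisms to commutative objects extend along η, which gives the adjunction. Adding
morphisms by codiagonals turns products of commutative objects into biproducts and inverts L(X × Y)
→ L(X) × L(Y). The reflective subcategory being full, ν is invertible and algebra structures are
unique. -/

namespace LinearReflector

/-! ### Quasi-injections, codiagonals and commutative objects -/

section Pointed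

variable {C : Type u} [Category.{v} C] [CartesianMonoidalCategory C] [HasZeroMorphisms C]

lemma lift_zero_right {Z X Y : C} (f : Z ⟶ X) : lift f (0 : Z ⟶ Y) = f ≫ quasiInl X Y := by
  simp [quasiInl]

lemma lift_zero_left {Z X Y : C} (f : Z ⟶ Y) : lift (0 : Z ⟶ X) f = f ≫ quasiInr X Y := by
  simp [quasiInr]

lemma eq_zero_of_unit_source {X : C} (f : 𝟙_ C ⟶ X) : f = 0 := by
  rw [← Category.id_comp f, toUnit_unique (𝟙 (𝟙_ C)) 0, zero_comp]

@[simp]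
lemma quasiInl_fst (X Y : C) : quasiInl X Y ≫ fst X Y = 𝟙 X := by simp [quasiInl]

@[simp]
lemma quasiInl_snd (X Y : C) : quasiInl X Y ≫ snd X Y = 0 := by simp [quasiInl]

@[simp]
lemma quasiInr_fst (X Y : C) : quasiInr X Y ≫ fst X Y = 0 := by simp [quasiInr]

@[simp]
lemma quasiInr_snd (X Y : C) : quasiInr X Y ≫ snd X Y = 𝟙 Y := by simp [quasiInr]

@[simp]
lemma quasiInl_fst_assoc {X Y Z : C} (f : X ⟶ Z) : quasiInl X Y ≫ fst X Y ≫ f = f := by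
  rw [← Category.assoc, quasiInl_fst, Category.id_comp]

@[simp]
lemma quasiInr_fst_assoc {X Y Z : C} (f : X ⟶ Z) : quasiInr X Y ≫ fst X Y ≫ f = 0 := by
  rw [← Category.assoc, quasiInr_fst, zero_comp]

@[simp]
lemma quasiInr_snd_assoc {X Y Z : C} (f : Y ⟶ Z) : quasiInr X Y ≫ snd X Y ≫ f = f := by
  rw [← Category.assoc, quasiInr_snd, Category.id_comp]

/-- The quasi-injections of a unital category are jointly epic. -/
lemma prod_hom_ext [IsUnital C] {X Y Z : C} {f g : X ⊗ Y ⟶ Z}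
    (h₁ : quasiInl X Y ≫ f = quasiInl X Y ≫ g) (h₂ : quasiInr X Y ≫ f = quasiInr X Y ≫ g) :
    f = g := by
  -- The equalizer of `f` and `g` is a monomorphism through which both quasi-injections factor.
  have := IsUnital.jointly_strongly_epic (equalizer.ι f g) (equalizer.lift _ h₁)
    (equalizer.lift _ h₂) (by simp) (by simp)
  rw [← cancel_epi (equalizer.ι f g), equalizer.condition]

/-- A codiagonal of `X`: a morphism `X × X ⟶ X` restricting to the identity along both
quasi-injections. -/
structure IsCodiagonal {X : C} (m : X ⊗ X ⟶ X) : Prop where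
  inl : quasiInl X X ≫ m = 𝟙 X
  inr : quasiInr X X ≫ m = 𝟙 X

namespace IsCodiagonal

variable {X : C} {m : X ⊗ X ⟶ X}

lemma lift_zero_right (h : IsCodiagonal m) {Z : C} (f : Z ⟶ X) : lift f 0 ≫ m = f := by
  rw [LinearReflector.lift_zero_right, Category.assoc, h.inl, Category.comp_id]

lemma lift_zero_left (h : IsCodiagonal m) {Z : C} (f : Z ⟶ X) : lift 0 f ≫ m = f := by
  rw [LinearReflector.lift_zero_left, Category.assoc, h.inr, Category.comp_id]

variable [IsUnital C]

/-- Every morphism between objects with a codiagonal commutes with the codiagonals. -/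
lemma comp (h : IsCodiagonal m) {Y : C} {n : Y ⊗ Y ⟶ Y} (h' : IsCodiagonal n) (f : X ⟶ Y) :
    m ≫ f = (f ⊗ₘ f) ≫ n := by
  apply prod_hom_ext
  · rw [reassoc_of% h.inl, ← Category.assoc, quasiInl_tensorHom, Category.assoc, h'.inl,
      Category.comp_id]
  · rw [reassoc_of% h.inr, ← Category.assoc, quasiInr_tensorHom, Category.assoc, h'.inr,
      Category.comp_id]

/-- The monoid structure given by a codiagonal. -/
@[reducible]
def monObj (h : IsCodiagonal m) : MonObj X where
  one := 0
  mul := m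
  one_mul := by
    have : (0 : 𝟙_ C ⟶ X) ▷ X = lift 0 (snd _ _) := by ext <;> simp
    rw [this, h.lift_zero_left, leftUnitor_hom]
  mul_one := by
    have : X ◁ (0 : 𝟙_ C ⟶ X) = lift (fst _ _) 0 := by ext <;> simp
    rw [this, h.lift_zero_right, rightUnitor_hom]
  mul_assoc := by
    -- Both sides restrict to `m` on the first factor `X ⊗ X`, and to `quasiInr X X ≫ m` on the last
    -- `X`.
    apply prod_hom_ext
    · have e₁ : quasiInl (X ⊗ X) X ≫ m ▷ X = m ≫ quasiInl X X := by
        ext <;> simp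
      have e₂ : quasiInl (X ⊗ X) X ≫ (α_ X X X).hom ≫ X ◁ m = 𝟙 _ := by
        have : quasiInl (X ⊗ X) X ≫ (α_ X X X).hom = X ◁ quasiInl X X := by
          ext <;> simp
        rw [reassoc_of% this, ← whiskerLeft_comp, h.inl, whiskerLeft_id]
      rw [reassoc_of% e₁, h.inl, reassoc_of% e₂, Category.comp_id]
    · have e₁ : quasiInr (X ⊗ X) X ≫ m ▷ X = quasiInr X X := by ext <;> simp
      have e₂ : quasiInr (X ⊗ X) X ≫ (α_ X X X).hom ≫ X ◁ m = quasiInr X X := by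
        have : quasiInr (X ⊗ X) X ≫ (α_ X X X).hom = quasiInr X X ≫ quasiInr X (X ⊗ X) := by
          ext <;> simp
        rw [reassoc_of% this]
        ext
        · simp
        · simp [h.inr]
      rw [reassoc_of% e₁, reassoc_of% e₂]

/-- The braiding exchanges the quasi-injections, along which `m` restricts to the identity. -/
lemma isCommMonObj [BraidedCategory C] (h : IsCodiagonal m) :
    @IsCommMonObj C _ _ _ X h.monObj := by
  let := h.monObj
  refine ⟨?_⟩
  change (β_ X X).hom ≫ m = m
  apply prod_hom_ext
  · have : quasiInl X X ≫ (β_ X X).hom = quasiInr X X := by ext <;> simp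
    rw [reassoc_of% this, h.inl, h.inr]
  · have : quasiInr X X ≫ (β_ X X).hom = quasiInl X X := by ext <;> simp
    rw [reassoc_of% this, h.inl, h.inr]

lemma commutativeObject [BraidedCategory C] (h : IsCodiagonal m) : commutativeObject C X :=
  ⟨h.monObj, h.isCommMonObj⟩

end IsCodiagonal

/-- The multiplication of an internal monoid is a codiagonal. -/
lemma isCodiagonal_mul (X : C) [MonObj X] : IsCodiagonal (MonObj.mul (X := X)) where
  inl := by
    have : quasiInl X X = (ρ_ X).inv ≫ X ◁ MonObj.one (X := X) := by
      ext
      · simp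
      · simp [eq_zero_of_unit_source (MonObj.one (X := X))]
    rw [this, Category.assoc, MonObj.mul_one, Iso.inv_hom_id]
  inr := by
    have : quasiInr X X = (λ_ X).inv ≫ MonObj.one (X := X) ▷ X := by
      ext
      · simp [eq_zero_of_unit_source (MonObj.one (X := X))]
      · simp
    rw [this, Category.assoc, MonObj.one_mul, Iso.inv_hom_id]

/-- Units are zero and multiplications are codiagonals. This yields the naturality of + and 0 and
the monoid condition on ν at no cost. -/
lemma isMonHom_of_isUnital [IsUnital C] {X Y : C} [MonObj X] [MonObj Y] (f : X ⟶ Y) :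
    IsMonHom f where
  one_hom := by simp [eq_zero_of_unit_source]
  mul_hom := (isCodiagonal_mul X).comp (isCodiagonal_mul Y) f

lemma commutativeObject_iff [IsUnital C] [BraidedCategory C] (X : C) :
    commutativeObject C X ↔ ∃ m : X ⊗ X ⟶ X, IsCodiagonal m :=
  ⟨fun ⟨_, _⟩ => ⟨_, isCodiagonal_mul X⟩, fun ⟨_, h⟩ => h.commutativeObject⟩

instance [IsUnital C] [BraidedCategory C] : (commutativeObject C).IsClosedUnderIsomorphisms where
  of_iso {X Y} e h := by
    rw [commutativeObject_iff] at h ⊢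
    obtain ⟨m, h⟩ := h
    refine ⟨(e.inv ⊗ₘ e.inv) ≫ m ≫ e.hom, ?_, ?_⟩
    · rw [← Category.assoc, quasiInl_tensorHom, Category.assoc, reassoc_of% h.inl, e.inv_hom_id]
    · rw [← Category.assoc, quasiInr_tensorHom, Category.assoc, reassoc_of% h.inr, e.inv_hom_id]

lemma commutativeObject_unit [IsUnital C] [BraidedCategory C] : commutativeObject C (𝟙_ C) :=
  (commutativeObject_iff _).2 ⟨toUnit _, toUnit_unique _ _, toUnit_unique _ _⟩

lemma commutativeObject_tensor [IsUnital C] [BraidedCategory C] {X Y : C}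
    (hX : commutativeObject C X) (hY : commutativeObject C Y) : commutativeObject C (X ⊗ Y) := by
  rw [commutativeObject_iff] at *
  obtain ⟨m, hm⟩ := hX
  obtain ⟨n, hn⟩ := hY
  refine ⟨lift ((fst X Y ⊗ₘ fst X Y) ≫ m) ((snd X Y ⊗ₘ snd X Y) ≫ n), ?_, ?_⟩
  · ext
    · rw [Category.assoc, lift_fst, ← Category.assoc, quasiInl_tensorHom, Category.assoc, hm.inl]
      simp
    · rw [Category.assoc, lift_snd, ← Category.assoc, quasiInl_tensorHom, Category.assoc, hn.inl]
      simp
  · ext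
    · rw [Category.assoc, lift_fst, ← Category.assoc, quasiInr_tensorHom, Category.assoc, hm.inr]
      simp
    · rw [Category.assoc, lift_snd, ← Category.assoc, quasiInr_tensorHom, Category.assoc, hn.inr]
      simp

/-- Indexed products are needed for biproducts of families over `Fin n`. -/
lemma commutativeObject_pi [IsUnital C] [BraidedCategory C] {J : Type*} (F : J → C) [HasProduct F]
    (hF : ∀ j, commutativeObject C (F j)) : commutativeObject C (∏ᶜ F) := by
  simp only [commutativeObject_iff] at *
  choose m hm using hF
  refine ⟨Pi.lift fun j => (Pi.π F j ⊗ₘ Pi.π F j) ≫ m j, ?_, ?_⟩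
  · ext j
    rw [Category.assoc, Pi.lift_π, ← Category.assoc, quasiInl_tensorHom, Category.assoc,
      (hm j).inl]
    simp
  · ext j
    rw [Category.assoc, Pi.lift_π, ← Category.assoc, quasiInr_tensorHom, Category.assoc,
      (hm j).inr]
    simp

/-! ### The coequalizer of the quasi-injections -/

section Coequalizer

variable [HasFiniteColimits C]

/-- The coequalizing morphism `X × X ⟶ coequalizerFunctor.obj X`. -/
noncomputable def coequalizerProj (X : C) : X ⊗ X ⟶ (coequalizerFunctor C).obj X :=
  coequalizer.π (quasiInl X X) (quasiInr X X)

instance (X : C) : IsRegularEpi (coequalizerProj X) :=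
  inferInstanceAs (IsRegularEpi (coequalizer.π (quasiInl X X) (quasiInr X X)))

lemma quasiInl_coequalizerProj (X : C) : quasiInl X X ≫ coequalizerProj X = toCoequalizer X :=
  rfl

lemma quasiInr_coequalizerProj (X : C) : quasiInr X X ≫ coequalizerProj X = toCoequalizer X :=
  (coequalizer.condition _ _).symm

lemma coequalizerProj_naturality {X Y : C} (f : X ⟶ Y) :
    coequalizerProj X ≫ (coequalizerFunctor C).map f = (f ⊗ₘ f) ≫ coequalizerProj Y :=
  coequalizer.π_desc _ _

lemma exists_coequalizerProj_comp {X A : C} (k : X ⊗ X ⟶ A)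
    (hk : quasiInl X X ≫ k = quasiInr X X ≫ k) :
    ∃ g : (coequalizerFunctor C).obj X ⟶ A, coequalizerProj X ≫ g = k :=
  ⟨coequalizer.desc k hk, coequalizer.π_desc _ _⟩

lemma toCoequalizer_naturality {X Y : C} (f : X ⟶ Y) :
    toCoequalizer X ≫ (coequalizerFunctor C).map f = f ≫ toCoequalizer Y := by
  rw [← quasiInl_coequalizerProj, Category.assoc, coequalizerProj_naturality, ← Category.assoc,
    quasiInl_tensorHom, Category.assoc, quasiInl_coequalizerProj]

/-- Morphisms to an object with a codiagonal extend along `toCoequalizer`. -/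
lemma exists_toCoequalizer_comp {X A : C} {m : A ⊗ A ⟶ A} (h : IsCodiagonal m) (f : X ⟶ A) :
    ∃ g : (coequalizerFunctor C).obj X ⟶ A, toCoequalizer X ≫ g = f := by
  have h₁ : quasiInl X X ≫ (f ⊗ₘ f) ≫ m = f := by
    rw [← Category.assoc, quasiInl_tensorHom, Category.assoc, h.inl, Category.comp_id]
  have h₂ : quasiInr X X ≫ (f ⊗ₘ f) ≫ m = f := by
    rw [← Category.assoc, quasiInr_tensorHom, Category.assoc, h.inr, Category.comp_id]
  obtain ⟨g, hg⟩ := exists_coequalizerProj_comp ((f ⊗ₘ f) ≫ m) (h₁.trans h₂.symm)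
  exact ⟨g, by rw [← quasiInl_coequalizerProj, Category.assoc, hg, h₁]⟩

/-- If η factors through a monomorphism `i`, the pullback of `i` along `coequalizerProj X` contains
both quasi-injections, so it is invertible. Then `coequalizerProj X`, a regular epimorphism, factors
through `i`. -/
instance [IsUnital C] (X : C) : ExtremalEpi (toCoequalizer X) := by
  apply ExtremalEpi.mk_of_hasEqualizers
  intro Z p i fac _
  have : IsIso (pullback.snd i (coequalizerProj X)) :=
    IsUnital.jointly_strongly_epic _
      (pullback.lift p (quasiInl X X) (by rw [fac, quasiInl_coequalizerProj]))
      (pullback.lift p (quasiInr X X) (by rw [fac, quasiInr_coequalizerProj]))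
      (pullback.lift_snd _ _ _) (pullback.lift_snd _ _ _)
  exact ExtremalEpi.isIso (coequalizerProj X)
    (inv (pullback.snd i (coequalizerProj X)) ≫ pullback.fst _ _) i
    (by rw [Category.assoc, pullback.condition, IsIso.inv_hom_id_assoc])

/-- For a commutative object, `toCoequalizer` has a retraction. -/
lemma exists_retraction_toCoequalizer [IsUnital C] [BraidedCategory C] (A : CMON C) :
    ∃ g : (coequalizerFunctor C).obj A.obj ⟶ A.obj, toCoequalizer A.obj ≫ g = 𝟙 A.obj :=
  have ⟨_, h⟩ := (commutativeObject_iff _).1 A.property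
  exists_toCoequalizer_comp h _

/-- The retraction of `toCoequalizer` for a commutative object. -/
noncomputable def ofCoequalizer [IsUnital C] [BraidedCategory C] (A : CMON C) :
    (coequalizerFunctor C).obj A.obj ⟶ A.obj :=
  (exists_retraction_toCoequalizer A).choose

@[simp]
lemma toCoequalizer_ofCoequalizer [IsUnital C] [BraidedCategory C] (A : CMON C) :
    toCoequalizer A.obj ≫ ofCoequalizer A = 𝟙 A.obj :=
  (exists_retraction_toCoequalizer A).choose_spec

lemma ofCoequalizer_naturality [IsUnital C] [BraidedCategory C] {A B : CMON C} (f : A ⟶ B) :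
    (coequalizerFunctor C).map f.hom ≫ ofCoequalizer B = ofCoequalizer A ≫ f.hom := by
  rw [← cancel_epi (toCoequalizer A.obj), reassoc_of% toCoequalizer_naturality,
    toCoequalizer_ofCoequalizer, reassoc_of% toCoequalizer_ofCoequalizer, Category.comp_id]

end Coequalizer

end Pointed

/-- Regular epimorphisms of a regular category are stable under finite products. -/
lemma isRegularEpi_tensorHom {C : Type u} [Category.{v} C] [CartesianMonoidalCategory C]
    [Regular C] {X Y X' Y' : C} (f : X ⟶ X') (g : Y ⟶ Y') [IsRegularEpi f] [IsRegularEpi g] :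
    IsRegularEpi (f ⊗ₘ g) := by
  have h₁ : IsPullback (fst X Y) (f ▷ Y) f (fst X' Y) := by
    refine ⟨⟨by simp⟩, ⟨PullbackCone.IsLimit.mk _ (fun s => lift s.fst (s.snd ≫ snd _ _))
      (by simp) (fun s => ?_) (fun s m h h' => ?_)⟩⟩
    · ext
      · simpa using s.condition
      · simp
    · ext
      · simpa using h
      · simp [← h']
  have h₂ : IsPullback (snd X' Y) (X' ◁ g) g (snd X' Y') := by
    refine ⟨⟨by simp⟩, ⟨PullbackCone.IsLimit.mk _ (fun s => lift (s.snd ≫ fst _ _) s.fst)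
      (by simp) (fun s => ?_) (fun s m h h' => ?_)⟩⟩
    · ext
      · simp
      · simpa using s.condition
    · ext
      · simp [← h']
      · simpa using h
  have : IsRegularEpi (f ▷ Y) :=
    Regular.regularEpiIsStableUnderBaseChange.of_isPullback h₁ ‹_›
  have : IsRegularEpi (X' ◁ g) :=
    Regular.regularEpiIsStableUnderBaseChange.of_isPullback h₂ ‹_›
  rw [MonoidalCategory.tensorHom_def]
  infer_instance

/-! ### The codiagonal of the coequalizer, and the adjunction -/

section Reflector

variable {C : Type u} [Category.{v} C] [CartesianMonoidalCategory C] [HasZeroMorphisms C]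
  [IsUnital C] [Regular C] [HasFiniteColimits C]

/-- The coequalizing morphism factors through `η × η`, where `η` is `toCoequalizer`; the induced
morphism is a codiagonal. -/
lemma exists_isCodiagonal_coequalizerFunctor (X : C) :
    ∃ m : (coequalizerFunctor C).obj X ⊗ (coequalizerFunctor C).obj X ⟶
      (coequalizerFunctor C).obj X, IsCodiagonal m := by
  let f := toCoequalizer X ⊗ₘ toCoequalizer X
  have : IsRegularEpi f := isRegularEpi_tensorHom _ _
  let R := pullback (toCoequalizer X) (toCoequalizer X)
  let p : R ⟶ X := pullback.fst _ _
  let q : R ⟶ X := pullback.snd _ _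
  -- `R` is the kernel pair of η. On each quasi-injection the equation is `p ≫ η = q ≫ η`.
  have hpq : (p ⊗ₘ p) ≫ coequalizerProj X = (q ⊗ₘ q) ≫ coequalizerProj X := by
    apply prod_hom_ext
    · simp only [← Category.assoc, quasiInl_tensorHom]
      simp only [Category.assoc, quasiInl_coequalizerProj]
      exact pullback.condition
    · simp only [← Category.assoc, quasiInr_tensorHom]
      simp only [Category.assoc, quasiInr_coequalizerProj]
      exact pullback.condition
  have h : IsRegularEpi.left f ≫ coequalizerProj X = IsRegularEpi.right f ≫ coequalizerProj X := by
    have w := IsRegularEpi.w f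
    -- The parallel pair whose coequalizer is η × η factors through `R ⊗ R`, with legs p × p and q ×
    -- q.
    let k : IsRegularEpi.W f ⟶ R ⊗ R := lift
      (pullback.lift (IsRegularEpi.left f ≫ fst _ _) (IsRegularEpi.right f ≫ fst _ _)
        (by simpa [f] using w =≫ fst _ _))
      (pullback.lift (IsRegularEpi.left f ≫ snd _ _) (IsRegularEpi.right f ≫ snd _ _)
        (by simpa [f] using w =≫ snd _ _))
    have hl : k ≫ (p ⊗ₘ p) = IsRegularEpi.left f := by
      ext <;> simpa [k, p] using pullback.lift_fst _ _ _
    have hr : k ≫ (q ⊗ₘ q) = IsRegularEpi.right f := by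
      ext <;> simpa [k, q] using pullback.lift_snd _ _ _
    rw [← hl, ← hr, Category.assoc, hpq, Category.assoc]
  refine ⟨IsRegularEpi.desc f _ h, ?_, ?_⟩
  · rw [← cancel_epi (toCoequalizer X), ← Category.assoc, ← quasiInl_tensorHom, Category.assoc,
      IsRegularEpi.fac, quasiInl_coequalizerProj, Category.comp_id]
  · rw [← cancel_epi (toCoequalizer X), ← Category.assoc, ← quasiInr_tensorHom, Category.assoc,
      IsRegularEpi.fac, quasiInr_coequalizerProj, Category.comp_id]

variable [BraidedCategory C]

lemma commutativeObject_coequalizerFunctor (X : C) :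
    commutativeObject C ((coequalizerFunctor C).obj X) :=
  (commutativeObject_iff _).2 (exists_isCodiagonal_coequalizerFunctor X)

variable (C) in
/-- The reflector onto the commutative objects. -/
noncomputable abbrev cmonFunctor : C ⥤ CMON C :=
  (commutativeObject C).lift (coequalizerFunctor C) commutativeObject_coequalizerFunctor

variable (C) in
/-- The adjunction between the reflector and the inclusion of the commutative objects. -/
noncomputable def cmonAdjunction : cmonFunctor C ⊣ (commutativeObject C).ι where
  unit :=
    { app := toCoequalizer
      naturality := fun _ _ f => (toCoequalizer_naturality f).symm }
  counit :=
    { app := fun A => ObjectProperty.homMk (ofCoequalizer A)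
      naturality := fun _ _ f => ObjectProperty.hom_ext _ (ofCoequalizer_naturality f) }
  left_triangle_components X := by
    ext
    change (coequalizerFunctor C).map (toCoequalizer X) ≫ ofCoequalizer ((cmonFunctor C).obj X) =
      𝟙 ((coequalizerFunctor C).obj X)
    rw [← cancel_epi (toCoequalizer X), reassoc_of% toCoequalizer_naturality]
    exact toCoequalizer X ≫= toCoequalizer_ofCoequalizer ((cmonFunctor C).obj X)
  right_triangle_components A := toCoequalizer_ofCoequalizer A

end Reflector

/-! ### Biproducts of commutative objects; in the multiplicative hom-monoids `1` is zero and `∏` is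
a sum -/

section Semiadditive

attribute [local instance] Hom.monoid Hom.commMonoid

variable {C : Type u} [Category.{v} C] [CartesianMonoidalCategory C]

lemma comp_prod [BraidedCategory C] {X Y A : C} [MonObj A] [IsCommMonObj A] {J : Type*}
    (s : Finset J) (f : X ⟶ Y) (g : J → (Y ⟶ A)) :
    f ≫ ∏ j ∈ s, g j = ∏ j ∈ s, f ≫ g j :=
  map_prod ({ toFun := fun g => f ≫ g, map_one' := MonObj.comp_one f,
              map_mul' := MonObj.comp_mul f } : (Y ⟶ A) →* (X ⟶ A)) g s

variable [HasZeroMorphisms C]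

lemma hom_one_eq_zero {X A : C} [MonObj A] : (1 : X ⟶ A) = 0 := by
  rw [Hom.one_def, eq_zero_of_unit_source (MonObj.one (X := A)), comp_zero]

variable [BraidedCategory C] [IsUnital C]

lemma prod_comp {X A B : C} [MonObj A] [IsCommMonObj A] [MonObj B] [IsCommMonObj B] {J : Type*}
    (s : Finset J) (g : J → (X ⟶ A)) (f : A ⟶ B) : (∏ j ∈ s, g j) ≫ f = ∏ j ∈ s, g j ≫ f :=
  have := isMonHom_of_isUnital f
  map_prod (IsMonHom.monoidHom f X) g s

variable (C) in
-- The product in `C` is commutative, and its identity is the sum of the `π j ≫ i j`; composition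
-- being bilinear, this makes it a coproduct too.
lemma hasFiniteBiproducts_cmon : HasFiniteBiproducts (CMON C) where
  out n := ⟨fun F => by
    classical
    let G : Fin n → C := fun j => (F j).obj
    let P : CMON C := ⟨∏ᶜ G, commutativeObject_pi G fun j => (F j).property⟩
    obtain ⟨_, _⟩ := P.property
    let i (j : Fin n) : G j ⟶ ∏ᶜ G :=
      Pi.lift fun k => if h : j = k then eqToHom (congrArg G h) else 0
    have hi (j k : Fin n) :
        i j ≫ Pi.π G k = if h : j = k then eqToHom (congrArg G h) else 0 := Pi.lift_π _ _
    have total : ∏ j, (Pi.π G j ≫ i j) = 𝟙 (∏ᶜ G) := by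
      ext k
      obtain ⟨_, _⟩ := (F k).property
      rw [prod_comp, Finset.prod_eq_single k]
      · simp [hi]
      · intro j _ hj
        rw [Category.assoc, hi, dif_neg hj, comp_zero, hom_one_eq_zero]
      · simp
    have desc_uniq {B : C} [MonObj B] [IsCommMonObj B] (u : ∏ᶜ G ⟶ B) (t : ∀ j, G j ⟶ B)
        (h : ∀ j, i j ≫ u = t j) : u = ∏ j, Pi.π G j ≫ t j := by
      -- Composing the decomposition of the identity with `u` determines `u` from the `i j ≫ u`.
      have hs := prod_comp Finset.univ (fun k => Pi.π G k ≫ i k) u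
      simpa only [total, Category.id_comp, Category.assoc, h] using hs
    refine HasBiproduct.mk
      { bicone :=
          { pt := P
            π := fun j => ObjectProperty.homMk (Pi.π G j)
            ι := fun j => ObjectProperty.homMk (i j)
            ι_π := fun j k => ?_ }
        isBilimit :=
          { isLimit := Fan.IsLimit.mk _
              (fun s => ObjectProperty.homMk (Pi.lift fun j => (s.proj j).hom))
              (fun s j => ?_) (fun s m h => ?_)
            isColimit := ?_ } }
    · ext
      change i j ≫ Pi.π G k = _
      rw [hi]
      split_ifs with h
      · subst h; rfl
      · rfl
    · ext
      exact Pi.lift_π _ _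
    · ext : 1
      refine Pi.hom_ext _ _ fun j => ?_
      exact (congrArg InducedCategory.Hom.hom (h j)).trans
        (Pi.lift_π (fun j => (s.proj j).hom) j).symm
    · refine Cofan.IsColimit.mk _
        (fun s =>
          letI := s.pt.property.choose
          haveI := s.pt.property.choose_spec
          ObjectProperty.homMk (∏ j, Pi.π G j ≫ (s.inj j).hom : ∏ᶜ G ⟶ s.pt.obj)) (fun s j => ?_)
        (fun s m h => ?_)
      · let := s.pt.property.choose
        have := s.pt.property.choose_spec
        ext
        change i j ≫ ∏ k, Pi.π G k ≫ (s.inj k).hom = (s.inj j).hom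
        rw [comp_prod, Finset.prod_eq_single j]
        · rw [← Category.assoc, hi, dif_pos rfl, eqToHom_refl, Category.id_comp]
        · intro k _ hk
          rw [← Category.assoc, hi, dif_neg hk.symm, zero_comp, hom_one_eq_zero]
        · simp
      · let := s.pt.property.choose
        have := s.pt.property.choose_spec
        ext
        exact desc_uniq m.hom _ fun k => congrArg InducedCategory.Hom.hom (h k)⟩

end Semiadditive

/-! ### The reflector preserves finite products -/

section FiniteProducts

variable {C : Type u} [Category.{v} C] [CartesianMonoidalCategory C] [HasZeroMorphisms C]
  [IsUnital C] [HasFiniteColimits C]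

lemma coequalizerFunctor_map_zero (X Y : C) : (coequalizerFunctor C).map (0 : X ⟶ Y) = 0 := by
  rw [← cancel_epi (toCoequalizer X), toCoequalizer_naturality, zero_comp, comp_zero]

lemma coequalizerFunctor_map_quasiInl_prodComparison (X Y : C) :
    (coequalizerFunctor C).map (quasiInl X Y) ≫
      CartesianMonoidalCategory.prodComparison (coequalizerFunctor C) X Y = quasiInl _ _ := by
  ext
  · simp [← Functor.map_comp]
  · simp [← Functor.map_comp, coequalizerFunctor_map_zero]

lemma coequalizerFunctor_map_quasiInr_prodComparison (X Y : C) :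
    (coequalizerFunctor C).map (quasiInr X Y) ≫
      CartesianMonoidalCategory.prodComparison (coequalizerFunctor C) X Y = quasiInr _ _ := by
  ext
  · simp [← Functor.map_comp, coequalizerFunctor_map_zero]
  · simp [← Functor.map_comp]

variable [Regular C]

instance (X Y : C) :
    IsIso (CartesianMonoidalCategory.prodComparison (coequalizerFunctor C) X Y) := by
  obtain ⟨m, hm⟩ := exists_isCodiagonal_coequalizerFunctor (X ⊗ Y)
  -- The inverse is the sum L(ι₁)π₁ + L(ι₂)π₂, formed with the codiagonal of L(X × Y).
  let k := ((coequalizerFunctor C).map (quasiInl X Y) ⊗ₘ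
    (coequalizerFunctor C).map (quasiInr X Y)) ≫ m
  have hl : quasiInl _ _ ≫ k = (coequalizerFunctor C).map (quasiInl X Y) := by
    rw [← Category.assoc, quasiInl_tensorHom, Category.assoc, hm.inl, Category.comp_id]
  have hr : quasiInr _ _ ≫ k = (coequalizerFunctor C).map (quasiInr X Y) := by
    rw [← Category.assoc, quasiInr_tensorHom, Category.assoc, hm.inr, Category.comp_id]
  refine ⟨k, ?_, ?_⟩
  · rw [← cancel_epi (toCoequalizer (X ⊗ Y)), Category.comp_id]
    apply prod_hom_ext
    · rw [← reassoc_of% toCoequalizer_naturality (X := _),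
        ← Category.assoc ((coequalizerFunctor C).map _),
        coequalizerFunctor_map_quasiInl_prodComparison, hl, toCoequalizer_naturality]
    · rw [← reassoc_of% toCoequalizer_naturality (X := _),
        ← Category.assoc ((coequalizerFunctor C).map _),
        coequalizerFunctor_map_quasiInr_prodComparison, hr, toCoequalizer_naturality]
  · apply prod_hom_ext
    · rw [← Category.assoc, hl, coequalizerFunctor_map_quasiInl_prodComparison, Category.comp_id]
    · rw [← Category.assoc, hr, coequalizerFunctor_map_quasiInr_prodComparison, Category.comp_id]

/-- η at the terminal object is both zero and epi, so its target is a zero object. -/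
instance : IsIso (CartesianMonoidalCategory.terminalComparison (coequalizerFunctor C)) := by
  refine ⟨0, ?_, toUnit_unique _ _⟩
  rw [← cancel_epi (toCoequalizer (𝟙_ C)), eq_zero_of_unit_source (toCoequalizer (𝟙_ C)),
    zero_comp, zero_comp]

instance : PreservesFiniteProducts (coequalizerFunctor C) := by
  have := preservesLimitsOfShape_discrete_walkingPair_of_isIso_prodComparison
    (coequalizerFunctor C)
  have := preservesLimit_empty_of_isIso_terminalComparison (coequalizerFunctor C)
  have := preservesLimitsOfShape_pempty_of_preservesTerminal (coequalizerFunctor C)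
  exact PreservesFiniteProducts.of_preserves_binary_and_terminal _

variable [BraidedCategory C]

instance : PreservesFiniteProducts (cmonFunctor C) where
  preserves n :=
    have : PreservesLimitsOfShape (Discrete (Fin n))
        (cmonFunctor C ⋙ (commutativeObject C).ι) :=
      inferInstanceAs (PreservesLimitsOfShape (Discrete (Fin n)) (coequalizerFunctor C))
    preservesLimitsOfShape_of_reflects_of_preserves _ (commutativeObject C).ι

variable (C) in
lemma isLinearReflector_cmonFunctor :
    IsLinearReflector (commutativeObject C) (cmonFunctor C) where
  linear :=
    { terminal_mem := commutativeObject_unit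
      prod_mem := fun _ _ => commutativeObject_tensor
      semiadditive := ⟨inferInstance, hasFiniteBiproducts_cmon C⟩ }
  reflector := ⟨cmonAdjunction C⟩
  preservesFiniteProducts := inferInstance

end FiniteProducts

/-! ### The monadic linear assignment and its algebras -/

section Assignment

variable {C : Type u} [Category.{v} C] [CartesianMonoidalCategory C] [BraidedCategory C]
  [HasZeroMorphisms C] [IsUnital C] [HasFiniteColimits C]

instance isIso_toCoequalizer (A : CMON C) : IsIso (toCoequalizer A.obj) :=
  ⟨ofCoequalizer A, toCoequalizer_ofCoequalizer A, by
    rw [← cancel_epi (toCoequalizer A.obj), reassoc_of% toCoequalizer_ofCoequalizer,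
      Category.comp_id]⟩

instance (A : CMON C) : IsIso (ofCoequalizer A) :=
  IsIso.of_isIso_fac_left (toCoequalizer_ofCoequalizer A)

/-- A commutative object is isomorphic to its reflection. -/
noncomputable def ofCoequalizerIso (A : CMON C) : (coequalizerFunctor C).obj A.obj ≅ A.obj :=
  asIso (ofCoequalizer A)

variable [Regular C]

instance : IsIso (cmonAdjunction C).toMonad.μ := by
  have (X : C) : IsIso ((cmonAdjunction C).toMonad.μ.app X) :=
    inferInstanceAs (IsIso (ofCoequalizer ((cmonFunctor C).obj X)))
  exact NatIso.isIso_of_isIso_app _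

lemma isIso_toCoequalizer_iff (A : C) : IsIso (toCoequalizer A) ↔ commutativeObject C A :=
  ⟨fun _ => (commutativeObject C).prop_of_iso (asIso (toCoequalizer A)).symm
    (commutativeObject_coequalizerFunctor A),
    fun h => isIso_toCoequalizer ⟨A, h⟩⟩

variable (C) in
/-- The monadic linear assignment given by the monad of the reflection onto the commutative
objects, with the codiagonals as additions. -/
noncomputable def coequalizerAssignment : MonadicLinearAssignment C where
  functor := (cmonAdjunction C).toMonad.toFunctor
  preservesFiniteProducts := inferInstanceAs (PreservesFiniteProducts (coequalizerFunctor C))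
  -- The choice is harmless: every monoid multiplication is the unique codiagonal.
  mon X := (commutativeObject_coequalizerFunctor X).choose
  comm X := (commutativeObject_coequalizerFunctor X).choose_spec
  add_naturality {X Y} f :=
    let := (commutativeObject_coequalizerFunctor X).choose
    let := (commutativeObject_coequalizerFunctor Y).choose
    (IsMonHom.mul_hom (self := isMonHom_of_isUnital ((coequalizerFunctor C).map f))).symm
  zero_naturality {X Y} f :=
    let := (commutativeObject_coequalizerFunctor X).choose
    let := (commutativeObject_coequalizerFunctor Y).choose
    IsMonHom.one_hom (self := isMonHom_of_isUnital ((coequalizerFunctor C).map f))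
  ν := asIso (cmonAdjunction C).toMonad.μ
  ν_isMonHom X :=
    @isMonHom_of_isUnital C _ _ _ _ _ _
      (commutativeObject_coequalizerFunctor ((coequalizerFunctor C).obj X)).choose
      (commutativeObject_coequalizerFunctor X).choose _
  ν_obj X := by
    let T := (cmonAdjunction C).toMonad
    change T.μ.app (T.obj X) = T.map (T.μ.app X)
    have : IsIso (T.η.app (T.obj X)) :=
      inferInstanceAs (IsIso (toCoequalizer ((cmonFunctor C).obj X).obj))
    -- By the two unit laws, both sides are retractions of the isomorphism T(η).
    rw [← cancel_epi (T.map (T.η.app (T.obj X))), T.right_unit, ← Functor.map_comp, T.left_unit,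
      CategoryTheory.Functor.map_id]
  unit := (cmonAdjunction C).toMonad.η
  assoc := (cmonAdjunction C).toMonad.assoc
  left_unit := (cmonAdjunction C).toMonad.left_unit
  right_unit := (cmonAdjunction C).toMonad.right_unit

/-- The structure morphism of an algebra is a retraction of the unit. -/
lemma toCoequalizer_comp_of_map_eq {A : C} (a : (coequalizerFunctor C).obj A ≅ A)
    (ha : (coequalizerFunctor C).map a.hom = (cmonAdjunction C).toMonad.μ.app A) :
    toCoequalizer A ≫ a.hom = 𝟙 A := by
  have h : toCoequalizer ((coequalizerFunctor C).obj A) ≫ (coequalizerFunctor C).map a.hom =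
      𝟙 ((coequalizerFunctor C).obj A) := by
    rw [ha]
    exact (cmonAdjunction C).toMonad.left_unit A
  -- Naturality turns the unit law into `a.hom ≫ η = 𝟙`; as `a` is invertible, the other composite
  -- is an identity too.
  rw [toCoequalizer_naturality] at h
  rw [← cancel_epi a.hom, reassoc_of% h, Category.comp_id]

/-- The algebra given by a commutative object. -/
noncomputable def algebraOfCMON (A : CMON C) :
    LinearAlgebra (coequalizerAssignment C).toLinearAssignment where
  obj := A.obj
  str := ofCoequalizerIso A
  map_str := by
    change (coequalizerFunctor C).map (ofCoequalizer A) =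
      ofCoequalizer ((cmonFunctor C).obj A.obj)
    rw [← cancel_epi ((coequalizerFunctor C).map (toCoequalizer A.obj)),
      ← CategoryTheory.Functor.map_comp, toCoequalizer_ofCoequalizer,
      CategoryTheory.Functor.map_id]
    exact ((cmonAdjunction C).toMonad.right_unit A.obj).symm

lemma commutativeObject_of_algebra
    (A : LinearAlgebra (coequalizerAssignment C).toLinearAssignment) :
    commutativeObject C A.obj :=
  (commutativeObject C).prop_of_iso A.str (commutativeObject_coequalizerFunctor A.obj)

/-- Structure morphisms are retractions of the epimorphism η, hence unique. This upgrades the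
equivalence with `CMON C` to an isomorphism of categories. -/
lemma LinearAlgebra.ext_of_obj_eq
    {A B : LinearAlgebra (coequalizerAssignment C).toLinearAssignment} (h : A.obj = B.obj) :
    A = B := by
  have hA := toCoequalizer_comp_of_map_eq A.str A.map_str
  have hB := toCoequalizer_comp_of_map_eq B.str B.map_str
  obtain ⟨X, a, _⟩ := A
  obtain ⟨Y, b, _⟩ := B
  obtain rfl : X = Y := h
  obtain rfl : a = b := by
    ext
    exact (cancel_epi (toCoequalizer X)).1 (hA.trans hB.symm)
  rfl

variable (C) in
/-- Commutative objects as algebras. -/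
noncomputable def cmonToAlgebra :
    CMON C ⥤ LinearAlgebra (coequalizerAssignment C).toLinearAssignment where
  obj := algebraOfCMON
  map f :=
    { hom := f.hom
      comm := ofCoequalizer_naturality f }
  map_id _ := rfl
  map_comp _ _ := rfl

variable (C) in
/-- The underlying commutative objects of the algebras. -/
def algebraToCMON : LinearAlgebra (coequalizerAssignment C).toLinearAssignment ⥤ CMON C where
  obj A := ⟨A.obj, commutativeObject_of_algebra A⟩
  map f := ObjectProperty.homMk f.hom
  map_id _ := rfl
  map_comp _ _ := rfl

instance (L : LinearAssignment C) : (LinearAlgebra.forget L).Faithful where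
  map_injective := LinearAlgebra.Hom.ext

variable (C) in
/-- The isomorphism between the categories of commutative objects and of algebras. -/
noncomputable def cmonIsoAlgebra :
    IsoCat (CMON C) (LinearAlgebra (coequalizerAssignment C).toLinearAssignment) where
  functor := cmonToAlgebra C
  inverse := algebraToCMON C
  unit_eq := rfl
  counit_eq := by
    have obj_eq (A) : (algebraToCMON C ⋙ cmonToAlgebra C).obj A = A :=
      LinearAlgebra.ext_of_obj_eq rfl
    refine CategoryTheory.Functor.ext obj_eq fun A B f => ?_
    apply (LinearAlgebra.forget _).map_injective
    simp only [Functor.map_comp, eqToHom_map]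
    have h : (LinearAlgebra.forget _).map ((algebraToCMON C ⋙ cmonToAlgebra C).map f) =
      (LinearAlgebra.forget _).map f := rfl
    -- The underlying objects agree definitionally, so the transports become identities once
    -- forgotten to `C`.
    erw [eqToHom_refl, eqToHom_refl, Category.id_comp, Category.comp_id]
    exact h

lemma algSharp_coequalizerAssignment :
    (coequalizerAssignment C).algSharp = commutativeObject C :=
  funext fun A => propext (isIso_toCoequalizer_iff A)

end Assignment

end LinearReflector

open LinearReflector
theorem mainTheorem8 {C : Type u} [Category.{v} C] [CartesianMonoidalCategory C]
    [BraidedCategory C] [HasZeroMorphisms C] [IsUnital C] [Regular C]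
    [HasFiniteColimits C] :
    ∃ (h : ∀ X : C, commutativeObject C
        ((coequalizerFunctor C).obj X))
      (adj : (commutativeObject C).lift (coequalizerFunctor C) h ⊣
        (commutativeObject C).ι),
      (∀ X : C, adj.unit.app X = toCoequalizer X) ∧
      IsLinearReflector (commutativeObject C)
        ((commutativeObject C).lift (coequalizerFunctor C) h) ∧
      ∃ L : MonadicLinearAssignment C,
        L.toMonad = adj.toMonad ∧
        (∀ X : C,
          quasiInl (L.functor.obj X) (L.functor.obj X) ≫
            MonObj.mul (X := L.functor.obj X) = 𝟙 (L.functor.obj X) ∧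
          quasiInr (L.functor.obj X) (L.functor.obj X) ≫
            MonObj.mul (X := L.functor.obj X) = 𝟙 (L.functor.obj X)) ∧
        (∀ A : C, commutativeObject C A ↔
          ∃ a : L.functor.obj A ≅ A, L.functor.map a.hom = L.ν.hom.app A) ∧
        (∃ e : IsoCat (CMON C)
            (LinearAlgebra L.toLinearAssignment),
          e.functor ⋙ LinearAlgebra.forget L.toLinearAssignment =
            (commutativeObject C).ι) ∧
        (∃ e : IsoCat (CMON C) L.algSharp.FullSubcategory,
          e.functor ⋙ L.algSharp.ι = (commutativeObject C).ι) := by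
  refine ⟨commutativeObject_coequalizerFunctor, cmonAdjunction C, fun _ => rfl,
    isLinearReflector_cmonFunctor C, coequalizerAssignment C, rfl,
    fun X => ⟨(isCodiagonal_mul _).inl, (isCodiagonal_mul _).inr⟩,
    fun A => ⟨fun h => ⟨(algebraOfCMON ⟨A, h⟩).str, (algebraOfCMON ⟨A, h⟩).map_str⟩,
      fun ⟨a, ha⟩ => commutativeObject_of_algebra ⟨A, a, ha⟩⟩,
    ⟨cmonIsoAlgebra C, rfl⟩, ?_⟩
  -- The two full subcategories are cut out by equal properties, so the identity serves.
  rw [algSharp_coequalizerAssignment]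
  exact ⟨IsoCat.refl _, rfl⟩
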